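/- **Corollary (Newton polytope shadows).** For $n \ge 2$, let $(U,V)$ be a uniformly random pair of orthonormal vectors in $\mathbb{R}^n$ (i.e. its law is the rotation-invariant probability measure on the set of pairs of orthonormal vectors). For a polytope $P \subseteq \mathbb{R}^n$, let $s(P)$ be the number of vertices of the random shadow $\pi(P) \subseteq \mathbb{R}^2$, where $\pi(x) = (U^{\intercal}x, V^{\intercal}x)$. There is an absolute constant $C > 0$ such that the following holds for all integers $n \ge 2$ and $k \ge 0$. Let $p \in \mathbb{R}[x_1,\dots,x_n]$ be a nonzero polynomial of (total) degree $k$ and let $P$ be its Newton polytope, that is, the convex hull in $\mathbb{R}^n$ of the exponent vectors of the monomials that occur in $p$ with nonzero coefficient. Then $s(P)$ is an integrable random variable and \[ 1 \le \mathbb{E}[s(P)], \qquad\text{and, if } k \ge 1, \qquad \mathbb{E}[s(P)] \le C\, n k . \] -/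

import Mathlib

open MeasureTheory ProbabilityTheory

noncomputable section

/-- The Newton polytope of a real polynomial in `n` variables: the convex hull in Euclidean space
of the exponent vectors of the monomials that occur in it with nonzero coefficient. -/
def newtonPolytope {n : ℕ} (p : MvPolynomial (Fin n) ℝ) : Set (EuclideanSpace ℝ (Fin n)) :=
  convexHull ℝ ((fun m : Fin n →₀ ℕ => WithLp.toLp 2 (fun i => (m i : ℝ))) '' (p.support : Set (Fin n →₀ ℕ)))

/-- The linear projection `x ↦ (Uᵀ x, Vᵀ x)` to the plane. -/
def shadowMap {n : ℕ} (U V : EuclideanSpace ℝ (Fin n)) :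
    EuclideanSpace ℝ (Fin n) →ₗ[ℝ] EuclideanSpace ℝ (Fin 2) where
  toFun x := !₂[inner ℝ U x, inner ℝ V x]
  map_add' x y := by
    ext i; fin_cases i <;> simp [inner_add_right]
  map_smul' c x := by
    ext i; fin_cases i <;> simp [inner_smul_right]

/-- The size of the shadow of `P` under `x ↦ (Uᵀ x, Vᵀ x)`: its number of vertices. -/
def shadowSize {n : ℕ} (P : Set (EuclideanSpace ℝ (Fin n)))
    (w : EuclideanSpace ℝ (Fin n) × EuclideanSpace ℝ (Fin n)) : ℕ :=
  (Set.extremePoints ℝ (shadowMap w.1 w.2 '' P)).ncard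

/-- `x / ‖x‖` (and `0` if `x = 0`). -/
def unitVector {n : ℕ} (x : EuclideanSpace ℝ (Fin n)) : EuclideanSpace ℝ (Fin n) :=
  ‖x‖⁻¹ • x

/-- Gram-Schmidt orthonormalization of a pair of vectors. -/
def orthonormalizePair {n : ℕ} (g : EuclideanSpace ℝ (Fin n) × EuclideanSpace ℝ (Fin n)) :
    EuclideanSpace ℝ (Fin n) × EuclideanSpace ℝ (Fin n) :=
  (unitVector g.1, unitVector (g.2 - inner ℝ (unitVector g.1) g.2 • unitVector g.1))

/-- The law of a uniformly random orthonormal pair `(U, V)` of vectors of `ℝⁿ`, `2 ≤ n`: the law of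
the Gram-Schmidt orthonormalization of two independent standard Gaussian vectors. That this is a
rotation invariant probability measure carried by the orthonormal pairs (the property which
characterizes the uniform distribution) is proved below. -/
def uniformFrame (n : ℕ) : Measure (EuclideanSpace ℝ (Fin n) × EuclideanSpace ℝ (Fin n)) :=
  ((stdGaussian (EuclideanSpace ℝ (Fin n))).prod (stdGaussian (EuclideanSpace ℝ (Fin n)))).map
    orthonormalizePair

lemma measurable_orthonormalizePair (n : ℕ) : Measurable (orthonormalizePair (n := n)) := by
  unfold orthonormalizePair unitVector
  fun_prop

instance isProbabilityMeasure_uniformFrame (n : ℕ) : IsProbabilityMeasure (uniformFrame n) :=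
  Measure.isProbabilityMeasure_map (measurable_orthonormalizePair n).aemeasurable

lemma uniformFrame_map_isometry {n : ℕ}
    (Q : EuclideanSpace ℝ (Fin n) ≃ₗᵢ[ℝ] EuclideanSpace ℝ (Fin n)) :
    (uniformFrame n).map (Prod.map Q Q) = uniformFrame n := by
  have hQ : Measurable Q := Q.continuous.measurable
  have h1 : Prod.map Q Q ∘ orthonormalizePair = orthonormalizePair ∘ Prod.map Q Q := by
    funext g
    have hu (x : EuclideanSpace ℝ (Fin n)) : unitVector (Q x) = Q (unitVector x) := by
      simp [unitVector]
    simp only [orthonormalizePair, Function.comp_apply, Prod.map_fst, Prod.map_snd, Prod.map_apply,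
      hu, Q.inner_map_map, ← map_smul, ← map_sub]
  have h2 := Measure.map_prod_map (stdGaussian (EuclideanSpace ℝ (Fin n)))
    (stdGaussian (EuclideanSpace ℝ (Fin n))) hQ hQ
  rw [stdGaussian_map] at h2
  unfold uniformFrame
  rw [Measure.map_map (hQ.prodMap hQ) (measurable_orthonormalizePair n), h1,
    ← Measure.map_map (measurable_orthonormalizePair n) (hQ.prodMap hQ), ← h2]

lemma ae_inner_ne_zero_stdGaussian {n : ℕ} (w : EuclideanSpace ℝ (Fin n)) (hw : w ≠ 0) :
    ∀ᵐ x ∂(stdGaussian (EuclideanSpace ℝ (Fin n))), inner ℝ w x ≠ 0 := by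
  have h := IsGaussian.map_eq_gaussianReal (μ := stdGaussian (EuclideanSpace ℝ (Fin n)))
    (innerSL ℝ w)
  rw [variance_dual_stdGaussian, integral_strongDual_stdGaussian] at h
  have hv : (‖innerSL ℝ w‖ ^ 2).toNNReal ≠ 0 := by
    have : 0 < ‖w‖ := norm_pos_iff.mpr hw
    simp [innerSL_apply_norm, hw]
  have := nullSingletonClass_gaussianReal (μ := 0) hv
  have h0 : (stdGaussian (EuclideanSpace ℝ (Fin n))).map (innerSL ℝ w) {0} = 0 := by
    rw [h]; exact measure_singleton 0
  rw [Measure.map_apply (by fun_prop) (measurableSet_singleton 0)] at h0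
  rw [ae_iff]
  convert h0 using 2
  ext x; simp

lemma norm_unitVector {n : ℕ} {x : EuclideanSpace ℝ (Fin n)} (hx : x ≠ 0) :
    ‖unitVector x‖ = 1 := by
  simp [unitVector, norm_smul, hx]

lemma ae_orthonormal_uniformFrame {n : ℕ} (hn : 2 ≤ n) :
    ∀ᵐ w ∂(uniformFrame n), ‖w.1‖ = 1 ∧ ‖w.2‖ = 1 ∧ inner ℝ w.1 w.2 = 0 := by
  have hm : MeasurableSet {w : EuclideanSpace ℝ (Fin n) × EuclideanSpace ℝ (Fin n) |
      ‖w.1‖ = 1 ∧ ‖w.2‖ = 1 ∧ inner ℝ w.1 w.2 = 0} := by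
    refine (IsClosed.inter ?_ (IsClosed.inter ?_ ?_)).measurableSet <;>
      exact isClosed_eq (by fun_prop) (by fun_prop)
  unfold uniformFrame
  rw [ae_map_iff (measurable_orthonormalizePair n).aemeasurable hm]
  have hpre := measurable_orthonormalizePair n hm
  refine (Measure.ae_prod_iff_ae_ae hpre).mpr ?_
  let i0 : Fin n := ⟨0, by omega⟩
  have he : EuclideanSpace.single i0 (1 : ℝ) ≠ 0 := by
    simp
  filter_upwards [ae_inner_ne_zero_stdGaussian _ he] with x hx
  have hx0 : x ≠ 0 := by
    rintro rfl; simp at hx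
  obtain ⟨w, hw, hxw⟩ : ∃ w : EuclideanSpace ℝ (Fin n), w ≠ 0 ∧ inner ℝ w x = 0 := by
    have hne : (Submodule.span ℝ {x})ᗮ ≠ ⊥ := by
      intro h
      have h1 := Submodule.finrank_add_finrank_orthogonal (Submodule.span ℝ {x})
      rw [h, finrank_span_singleton hx0] at h1
      simp at h1
      omega
    obtain ⟨w, hw, hw0⟩ := Submodule.exists_mem_ne_zero_of_ne_bot hne
    exact ⟨w, hw0, Submodule.mem_orthogonal_singleton_iff_inner_left.mp hw⟩
  filter_upwards [ae_inner_ne_zero_stdGaussian w hw] with y hy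
  have hu : ‖unitVector x‖ = 1 := norm_unitVector hx0
  have hd : y - inner ℝ (unitVector x) y • unitVector x ≠ 0 := by
    intro h
    apply hy
    rw [sub_eq_zero.mp h]
    simp [unitVector, inner_smul_right, hxw]
  refine ⟨hu, norm_unitVector hd, ?_⟩
  simp only [orthonormalizePair]
  rw [unitVector.eq_1 (y - _), inner_smul_right, inner_sub_right, inner_smul_right,
    real_inner_self_eq_norm_sq, hu]
  ring

end

open scoped ENNReal

/-! A vertex of the shadow is the strict projected maximizer on an open cone of directions in the
plane. The frame lies in the span of two Gaussian vectors `g`, `h`, and up to positive scaling every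
nonzero combination of them is `±g + t h` or `±h + t g` with `|t| ≤ 1`. So there are at most 4
vertices plus the number of changes of the maximizing exponent along four segments
(`IsArgmaxSelection.eventually_card_shadowVertices_le`).

To count changes along `g + t h`, cut it into `2N` steps of `h / N` and make each step one
coordinate at a time. As the direction moves along axis `j`, the `j`-th entry of the maximizing
exponent is monotone with values in `{0, …, k}`, and it changes whenever the maximizer does. Hence
on each line the points whose maximizer changes under a shift by `ε` have length at most `k |ε|`,
and a Gaussian density below 1 turns this into a probability (`stdGaussian_ne_single_le`). Summing
over coordinates and steps, `N` cancels and leaves `2k ∑ |h j|`, of mean at most `2kn`. Fatou's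
lemma as `N → ∞` gives `4(1 + 2kn)`. -/

/-- The exponent vector of a monomial, as a point of Euclidean space. -/
noncomputable def exponentPoint {n : ℕ} (m : Fin n →₀ ℕ) : EuclideanSpace ℝ (Fin n) :=
  WithLp.toLp 2 (fun i => (m i : ℝ))

lemma inner_single_exponentPoint {n : ℕ} (j : Fin n) (t : ℝ) (m : Fin n →₀ ℕ) :
    inner ℝ (EuclideanSpace.single j t) (exponentPoint m) = t * m j := by
  simp [exponentPoint, EuclideanSpace.inner_single_left]

lemma single_add_single {n : ℕ} (j : Fin n) (x y : ℝ) :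
    (EuclideanSpace.single j x + EuclideanSpace.single j y : EuclideanSpace ℝ (Fin n))
      = EuclideanSpace.single j (x + y) := by
  ext i
  by_cases h : i = j
  · subst h; simp
  · simp [h]

/-! ### Argmax selections and their monotonicity along coordinate axes -/

/-- `f w` maximizes `⟪w, ·⟫` over `A`, with ties broken by the smallest value of the index `r`. -/
structure IsArgmaxSelection {n : ℕ} (A : Finset (Fin n →₀ ℕ)) (r : (Fin n →₀ ℕ) → ℕ)
    (f : EuclideanSpace ℝ (Fin n) → (Fin n →₀ ℕ)) : Prop where
  mem : ∀ w, f w ∈ A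
  inner_le : ∀ w, ∀ b ∈ A, inner ℝ w (exponentPoint b) ≤ inner ℝ w (exponentPoint (f w))
  index_le : ∀ w, ∀ b ∈ A, inner ℝ w (exponentPoint b) = inner ℝ w (exponentPoint (f w)) →
    r (f w) ≤ r b

lemma exists_isArgmaxSelection {n : ℕ} {A : Finset (Fin n →₀ ℕ)} (hA : A.Nonempty)
    (r : (Fin n →₀ ℕ) → ℕ) : ∃ f, IsArgmaxSelection A r f := by
  classical
  have h (w : EuclideanSpace ℝ (Fin n)) : ∃ a ∈ A,
      (∀ b ∈ A, inner ℝ w (exponentPoint b) ≤ inner ℝ w (exponentPoint a)) ∧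
      ∀ b ∈ A, inner ℝ w (exponentPoint b) = inner ℝ w (exponentPoint a) → r a ≤ r b := by
    obtain ⟨a₀, ha₀, hmax⟩ := A.exists_max_image (fun b => inner ℝ w (exponentPoint b)) hA
    obtain ⟨a, ha, hmin⟩ := (A.filter fun b =>
      inner ℝ w (exponentPoint b) = inner ℝ w (exponentPoint a₀)).exists_min_image r
      ⟨a₀, by simp [ha₀]⟩
    simp only [Finset.mem_filter] at ha hmin
    refine ⟨a, ha.1, fun b hb => ?_, fun b hb hab => hmin b ⟨hb, hab.trans ha.2⟩⟩
    rw [ha.2]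
    exact hmax b hb
  choose f h1 h2 h3 using h
  exact ⟨f, h1, h2, h3⟩

namespace IsArgmaxSelection

variable {n : ℕ} {A : Finset (Fin n →₀ ℕ)} {r : (Fin n →₀ ℕ) → ℕ}
  {f : EuclideanSpace ℝ (Fin n) → (Fin n →₀ ℕ)}

lemma eq_iff (hf : IsArgmaxSelection A r f) (hr : Function.Injective r)
    (w : EuclideanSpace ℝ (Fin n)) {a : Fin n →₀ ℕ} (ha : a ∈ A) :
    f w = a ↔ ∀ b ∈ A, inner ℝ w (exponentPoint b) ≤ inner ℝ w (exponentPoint a) ∧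
      (inner ℝ w (exponentPoint b) = inner ℝ w (exponentPoint a) → r a ≤ r b) := by
  constructor
  · rintro rfl b hb
    exact ⟨hf.inner_le w b hb, hf.index_le w b hb⟩
  · intro h
    have heq : inner ℝ w (exponentPoint (f w)) = inner ℝ w (exponentPoint a) :=
      le_antisymm (h _ (hf.mem w)).1 (hf.inner_le w a ha)
    exact hr (le_antisymm (hf.index_le w a ha heq.symm) ((h _ (hf.mem w)).2 heq))

/-- Passing to the natural number `r (f w)` avoids any measurable structure on exponents; each level
set is a finite intersection of linear conditions. -/
lemma measurable_index (hf : IsArgmaxSelection A r f) (hr : Function.Injective r) :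
    Measurable fun w => r (f w) := by
  refine measurable_to_countable' fun y => ?_
  by_cases hy : ∃ a ∈ A, r a = y
  · obtain ⟨a, ha, rfl⟩ := hy
    have : (fun w => r (f w)) ⁻¹' {r a} = ⋂ b ∈ A,
        {w | inner ℝ w (exponentPoint b) ≤ inner ℝ w (exponentPoint a) ∧
        (inner ℝ w (exponentPoint b) = inner ℝ w (exponentPoint a) → r a ≤ r b)} := by
      ext w
      simp [hr.eq_iff, hf.eq_iff hr w ha]
    rw [this]
    refine A.measurableSet_biInter fun b _ => ?_
    have hm (m : Fin n →₀ ℕ) : Measurable fun w : EuclideanSpace ℝ (Fin n) =>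
        inner ℝ w (exponentPoint m) := by fun_prop
    exact (measurableSet_le (hm b) (hm a)).inter
      ((measurableSet_eq_fun (hm b) (hm a)).imp (MeasurableSet.const _))
  · have : (fun w => r (f w)) ⁻¹' {y} = ∅ := by
      ext w
      simpa using fun h => hy ⟨f w, hf.mem w, h⟩
    rw [this]
    exact MeasurableSet.empty

lemma measurableSet_ne {α : Type*} [MeasurableSpace α] (hf : IsArgmaxSelection A r f)
    (hr : Function.Injective r) {φ ψ : α → EuclideanSpace ℝ (Fin n)} (hφ : Measurable φ)
    (hψ : Measurable ψ) : MeasurableSet {x | f (φ x) ≠ f (ψ x)} := by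
  have : {x | f (φ x) ≠ f (ψ x)} = {x | r (f (φ x)) = r (f (ψ x))}ᶜ := by
    ext x; simp [hr.eq_iff]
  rw [this]
  exact (measurableSet_eq_fun ((hf.measurable_index hr).comp hφ)
    ((hf.measurable_index hr).comp hψ)).compl

/-- Adding the two maximality inequalities, at `w` and at the shifted direction, gives the weak
inequality. If the `j`-th entries agreed, both exponents would be tied in both directions, and the
common tie-break would make them equal. -/
lemma coord_lt (hf : IsArgmaxSelection A r f) (hr : Function.Injective r)
    (w : EuclideanSpace ℝ (Fin n)) (j : Fin n) {t : ℝ} (ht : 0 < t)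
    (hne : f w ≠ f (w + EuclideanSpace.single j t)) :
    f w j < f (w + EuclideanSpace.single j t) j := by
  set w' := w + EuclideanSpace.single j t with hw'
  have h1 := hf.inner_le w _ (hf.mem w')
  have h2 := hf.inner_le w' _ (hf.mem w)
  have h3 (m : Fin n →₀ ℕ) : inner ℝ w' (exponentPoint m)
      = inner ℝ w (exponentPoint m) + t * m j := by
    rw [hw', inner_add_left, inner_single_exponentPoint]
  rw [h3, h3] at h2
  have h4 : (f w j : ℝ) ≤ f w' j := by
    by_contra! h
    nlinarith [mul_lt_mul_of_pos_left h ht]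
  refine lt_of_le_of_ne (by exact_mod_cast h4) fun heq => hne ?_
  rw [heq] at h2
  have h5 := le_antisymm h1 (by linarith)
  refine hr (le_antisymm (hf.index_le w _ (hf.mem w') h5) (hf.index_le w' _ (hf.mem w) ?_))
  rw [h3, h3, h5, heq]

lemma coord_mono (hf : IsArgmaxSelection A r f) (hr : Function.Injective r)
    (w : EuclideanSpace ℝ (Fin n)) (j : Fin n) :
    Monotone fun x : ℝ => f (w + EuclideanSpace.single j x) j := by
  intro x y hxy
  rcases hxy.eq_or_lt with rfl | hlt
  · rfl
  by_cases h : f (w + EuclideanSpace.single j x) = f (w + EuclideanSpace.single j y)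
  · simp [h]
  · have h1 : w + EuclideanSpace.single j y
        = (w + EuclideanSpace.single j x) + EuclideanSpace.single j (y - x) := by
      rw [add_assoc, single_add_single]; simp
    have := hf.coord_lt hr (w + EuclideanSpace.single j x) j (sub_pos.2 hlt) (by rwa [← h1])
    rw [← h1] at this
    exact this.le

end IsArgmaxSelection

/-! ### Probability that a shift of a Gaussian direction changes the argmax -/

lemma gaussianReal_le_volume (s : Set ℝ) : gaussianReal 0 1 s ≤ volume s := by
  rw [gaussianReal_apply 0 one_ne_zero]
  calc ∫⁻ x in s, gaussianPDF 0 1 x ≤ ∫⁻ _ in s, 1 := by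
        refine lintegral_mono fun x => ?_
        rw [gaussianPDF, ← ENNReal.ofReal_one]
        refine ENNReal.ofReal_le_ofReal ?_
        rw [gaussianPDFReal]
        refine mul_le_one₀ (inv_le_one_of_one_le₀ ?_) (Real.exp_nonneg _) ?_
        · rw [Real.one_le_sqrt]
          have := Real.pi_gt_three
          norm_num
          linarith
        · rw [Real.exp_le_one_iff]
          have := sq_nonneg x
          norm_num
          linarith
    _ = volume s := by simp

/-- A monotone function with values in `{0, …, k}` changes between `x` and `x + ε` only on a set of
length at most `k |ε|`. -/
lemma volume_ne_shift_le {F : ℝ → ℕ} (hF : Monotone F) {k : ℕ} (hk : ∀ x, F x ≤ k) (ε : ℝ) :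
    volume {x | F x ≠ F (x + ε)} ≤ k * ENNReal.ofReal |ε| := by
  -- A change of `F` crosses some integer level `l` in `{1, …, k}`. By monotonicity `F` crosses `l`
  -- at one place, so two points of `T l` are at most `|ε|` apart.
  let T (l : ℕ) : Set ℝ := {x | (F x < l ∧ l ≤ F (x + ε)) ∨ (F (x + ε) < l ∧ l ≤ F x)}
  have hsub : {x | F x ≠ F (x + ε)} ⊆ ⋃ l ∈ Finset.Icc 1 k, T l := by
    intro x hx
    simp only [Set.mem_iUnion, Finset.mem_Icc, T, Set.mem_ofPred_eq]
    have h1 := hk x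
    have h2 := hk (x + ε)
    rcases lt_or_gt_of_ne hx with h | h
    · exact ⟨F (x + ε), by omega, by omega⟩
    · exact ⟨F x, by omega, by omega⟩
  have hT (l : ℕ) : volume (T l) ≤ ENNReal.ofReal |ε| := by
    refine (Real.volume_le_diam _).trans (Metric.ediam_le fun x hx y hy => ?_)
    rw [edist_dist]
    refine ENNReal.ofReal_le_ofReal ?_
    rw [Real.dist_eq]
    wlog hxy : x ≤ y generalizing x y
    · rw [abs_sub_comm]
      exact this y hy x hx (le_of_not_ge hxy)
    rw [abs_sub_comm, abs_of_nonneg (sub_nonneg.2 hxy)]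
    by_contra! hlt
    rcases le_total 0 ε with hε | hε
    · rw [abs_of_nonneg hε] at hlt
      have h1 : F (x + ε) ≤ F y := hF (by linarith)
      have h2 : F x ≤ F (x + ε) := hF (by linarith)
      have h3 : F y ≤ F (y + ε) := hF (by linarith)
      rcases hx with hx | hx <;> rcases hy with hy | hy <;> omega
    · rw [abs_of_nonpos hε] at hlt
      have h1 : F x ≤ F (y + ε) := hF (by linarith)
      have h2 : F (x + ε) ≤ F x := hF (by linarith)
      have h3 : F (y + ε) ≤ F y := hF (by linarith)
      rcases hx with hx | hx <;> rcases hy with hy | hy <;> omega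
  calc volume {x | F x ≠ F (x + ε)} ≤ volume (⋃ l ∈ Finset.Icc 1 k, T l) := measure_mono hsub
    _ ≤ ∑ l ∈ Finset.Icc 1 k, volume (T l) := measure_biUnion_finset_le _ _
    _ ≤ ∑ l ∈ Finset.Icc 1 k, ENNReal.ofReal |ε| := Finset.sum_le_sum fun l _ => hT l
    _ = k * ENNReal.ofReal |ε| := by simp

/-- A set whose slices in one coordinate direction have small Gaussian measure has small
Gaussian measure. -/
lemma stdGaussian_le_of_slice_le {n : ℕ} {S : Set (EuclideanSpace ℝ (Fin n))}
    (hS : MeasurableSet S) (j : Fin n) {B : ℝ≥0∞}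
    (h : ∀ w, gaussianReal 0 1 {x : ℝ | w + EuclideanSpace.single j x ∈ S} ≤ B) :
    stdGaussian (EuclideanSpace ℝ (Fin n)) S ≤ B := by
  have hm : Measurable (WithLp.toLp 2 : (Fin n → ℝ) → EuclideanSpace ℝ (Fin n)) := by fun_prop
  rw [← map_pi_eq_stdGaussian, Measure.map_apply hm hS, ← lintegral_indicator_one (hm hS)]
  have hle : ∫⁻ x, (WithLp.toLp 2 ⁻¹' S).indicator 1 x
        ∂(Measure.pi fun _ : Fin n => gaussianReal 0 1)
      ≤ ∫⁻ _, B ∂(Measure.pi fun _ : Fin n => gaussianReal 0 1) := by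
    -- Integrate out coordinate `j` alone: the inner integral is the Gaussian measure of a slice.
    refine lintegral_le_of_lmarginal_le {j} (measurable_one.indicator (hm hS))
      measurable_const fun x => ?_
    rw [lmarginal_singleton, lmarginal_singleton]
    simp only [lintegral_const, measure_univ, mul_one]
    have hmeas : MeasurableSet {y : ℝ | Function.update x j y ∈ (WithLp.toLp 2 ⁻¹' S)} :=
      (measurable_update x) (hm hS)
    have heq : (fun y : ℝ => (WithLp.toLp 2 ⁻¹' S).indicator (1 : (Fin n → ℝ) → ℝ≥0∞)
        (Function.update x j y)) =
        {y : ℝ | Function.update x j y ∈ (WithLp.toLp 2 ⁻¹' S)}.indicator 1 := by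
      ext y
      simp [Set.indicator]
    rw [heq, lintegral_indicator_one hmeas]
    convert h (WithLp.toLp 2 (Function.update x j 0)) using 3
    ext y
    simp only [Set.mem_preimage]
    congr! 1
    ext i
    by_cases hi : i = j
    · subst hi; simp
    · simp [hi]
  simpa using hle

namespace IsArgmaxSelection

variable {n : ℕ} {A : Finset (Fin n →₀ ℕ)} {r : (Fin n →₀ ℕ) → ℕ}
  {f : EuclideanSpace ℝ (Fin n) → (Fin n →₀ ℕ)}

/-- On every line parallel to axis `j`, `coord_lt` makes a change of the exponent a change of its
`j`-th entry, to which `volume_ne_shift_le` applies. -/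
lemma stdGaussian_ne_single_le (hf : IsArgmaxSelection A r f) (hr : Function.Injective r) {k : ℕ}
    (hk : ∀ a ∈ A, ∀ i, a i ≤ k) (c : EuclideanSpace ℝ (Fin n)) (j : Fin n) (ε : ℝ) :
    stdGaussian (EuclideanSpace ℝ (Fin n))
      {g | f (g + c) ≠ f (g + (c + EuclideanSpace.single j ε))} ≤ k * ENNReal.ofReal |ε| := by
  refine stdGaussian_le_of_slice_le (hf.measurableSet_ne hr (by fun_prop) (by fun_prop)) j
    fun w => ?_
  refine (gaussianReal_le_volume _).trans (le_trans (measure_mono ?_)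
    (volume_ne_shift_le (hf.coord_mono hr (w + c) j) (fun x => hk _ (hf.mem _) j) ε))
  intro x hx
  have h1 : w + EuclideanSpace.single j x + c = w + c + EuclideanSpace.single j x := by abel
  have h2 : w + EuclideanSpace.single j x + (c + EuclideanSpace.single j ε)
      = w + c + EuclideanSpace.single j (x + ε) := by
    rw [← single_add_single]; abel
  have h3 : w + c + EuclideanSpace.single j (x + ε)
      = w + c + EuclideanSpace.single j x + EuclideanSpace.single j ε := by
    rw [← single_add_single]; abel
  simp only [Set.mem_ofPred_eq, h1, h2] at hx ⊢
  rcases lt_trichotomy ε 0 with hε | rfl | hε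
  · have h4 : w + c + EuclideanSpace.single j x
        = w + c + EuclideanSpace.single j (x + ε) + EuclideanSpace.single j (-ε) := by
      rw [h3, add_assoc _ _ (EuclideanSpace.single j (-ε)), single_add_single]; simp
    have := hf.coord_lt hr _ j (neg_pos.2 hε) (by rw [← h4]; exact hx.symm)
    rw [← h4] at this
    exact this.ne'
  · simp at hx
  · have := hf.coord_lt hr _ j hε (by rwa [← h3])
    rw [← h3] at this
    exact this.ne

/-- Telescoping: `v` is added one coordinate at a time, with a union bound over the coordinates. -/
lemma stdGaussian_ne_le (hf : IsArgmaxSelection A r f) (hr : Function.Injective r) {k : ℕ}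
    (hk : ∀ a ∈ A, ∀ i, a i ≤ k) (c v : EuclideanSpace ℝ (Fin n)) :
    stdGaussian (EuclideanSpace ℝ (Fin n)) {g | f (g + c) ≠ f (g + (c + v))}
      ≤ k * ∑ j, ENNReal.ofReal |v j| := by
  classical
  have key (s : Finset (Fin n)) : stdGaussian (EuclideanSpace ℝ (Fin n))
      {g | f (g + c) ≠ f (g + (c + ∑ j ∈ s, EuclideanSpace.single j (v j)))}
      ≤ k * ∑ j ∈ s, ENNReal.ofReal |v j| := by
    induction s using Finset.induction_on with
    | empty => simp
    | insert j s hj ih =>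
      rw [Finset.sum_insert hj, Finset.sum_insert hj, mul_add,
        add_comm ((k : ℝ≥0∞) * ENNReal.ofReal _)]
      refine le_trans (measure_mono ?_) ((measure_union_le _ _).trans (add_le_add ih
        (hf.stdGaussian_ne_single_le hr hk
          (c + ∑ i ∈ s, EuclideanSpace.single i (v i)) j (v j))))
      intro g hg
      by_contra hn
      simp only [Set.mem_union, Set.mem_ofPred_eq, not_or, not_not] at hn hg
      apply hg
      rw [hn.1, hn.2]
      congr 2
      abel
  have hv : ∑ j, EuclideanSpace.single j (v j) = v := by
    ext i
    simp [Finset.sum_apply, Pi.single_apply]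
  simpa [hv] using key Finset.univ

end IsArgmaxSelection

/-! ### Shadow vertices as a measurable selection of exponents -/

lemma inner_shadowMap {n : ℕ} (U V x : EuclideanSpace ℝ (Fin n)) (c d : ℝ) :
    c * shadowMap U V x 0 + d * shadowMap U V x 1 = inner ℝ (c • U + d • V) x := by
  simp [shadowMap, inner_add_left, inner_smul_left]

/-- The extreme points of the convex hull of a finite plane set are the points that some rational
direction strictly separates from all the others. -/
lemma mem_extremePoints_convexHull_iff_exists_rat {T : Set (EuclideanSpace ℝ (Fin 2))}
    (hT : T.Finite) {q : EuclideanSpace ℝ (Fin 2)} (hq : q ∈ T) :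
    q ∈ Set.extremePoints ℝ (convexHull ℝ T) ↔
      ∃ x y : ℚ, ∀ p ∈ T, p = q ∨ (x : ℝ) * p 0 + y * p 1 < x * q 0 + y * q 1 := by
  constructor
  · intro h
    have hnot : q ∉ convexHull ℝ (T \ {q}) := by
      intro hmem
      have h2 := ((convex_convexHull ℝ T).mem_extremePoints_iff_mem_sdiff_convexHull_sdiff).1 h
      exact h2.2 (convexHull_mono (Set.sdiff_subset_sdiff_left (subset_convexHull ℝ T)) hmem)
    obtain ⟨φ, u, h1, h2⟩ := geometric_hahn_banach_closed_point (convex_convexHull ℝ (T \ {q}))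
      ((hT.subset Set.sdiff_subset).isClosed_convexHull ℝ) hnot
    have hφ (p : EuclideanSpace ℝ (Fin 2)) : φ p = φ (EuclideanSpace.single 0 1) * p 0
        + φ (EuclideanSpace.single 1 1) * p 1 := by
      have hp : p = p 0 • EuclideanSpace.single 0 (1 : ℝ) + p 1 • EuclideanSpace.single 1 (1 : ℝ) := by
        ext i; fin_cases i <;> simp
      conv_lhs => rw [hp]
      simp [mul_comm]
    -- The strictly separating directions form an open set, nonempty by Hahn–Banach, so it contains
    -- a rational point.
    let O : Set (ℝ × ℝ) := ⋂ p ∈ T \ {q}, {z | z.1 * p 0 + z.2 * p 1 < z.1 * q 0 + z.2 * q 1}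
    have hO : IsOpen O := (hT.subset Set.sdiff_subset).isOpen_biInter fun p _ =>
      isOpen_lt (by fun_prop) (by fun_prop)
    have hmem : (φ (EuclideanSpace.single 0 1), φ (EuclideanSpace.single 1 1)) ∈ O := by
      simp only [O, Set.mem_iInter, Set.mem_ofPred_eq]
      intro p hp
      rw [← hφ, ← hφ]
      exact (h1 p (subset_convexHull ℝ _ hp)).trans h2
    have hdense : DenseRange (Prod.map ((↑) : ℚ → ℝ) ((↑) : ℚ → ℝ)) :=
      Rat.denseRange_cast.prodMap Rat.denseRange_cast
    obtain ⟨⟨x, y⟩, hxy⟩ := hdense.exists_mem_open hO ⟨_, hmem⟩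
    refine ⟨x, y, fun p hp => ?_⟩
    by_cases hpq : p = q
    · exact Or.inl hpq
    · simp only [O, Set.mem_iInter] at hxy
      exact Or.inr (hxy p ⟨hp, hpq⟩)
  · rintro ⟨x, y, h⟩
    -- An open half-plane (possibly empty) together with the point `q` on its boundary line is
    -- convex, so separation on `T` passes to the hull and exposes `q`.
    have hconv : Convex ℝ {p : EuclideanSpace ℝ (Fin 2) |
        p = q ∨ (x : ℝ) * p 0 + y * p 1 < x * q 0 + y * q 1} := by
      rw [convex_iff_forall_pos]
      intro p hp p' hp' s t hs ht hst
      have hq' : s • q + t • q = q := by rw [← add_smul, hst, one_smul]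
      have hst' : s * (x * q 0 + y * q 1) + t * (x * q 0 + y * q 1) = x * q 0 + y * q 1 := by
        rw [← add_mul, hst, one_mul]
      rcases hp with rfl | hp <;> rcases hp' with rfl | hp'
      · exact Or.inl hq'
      · refine Or.inr ?_
        have := mul_lt_mul_of_pos_left hp' ht
        simp only [PiLp.add_apply, PiLp.smul_apply, smul_eq_mul]
        linarith
      · refine Or.inr ?_
        have := mul_lt_mul_of_pos_left hp hs
        simp only [PiLp.add_apply, PiLp.smul_apply, smul_eq_mul]
        linarith
      · refine Or.inr ?_
        have h1 := mul_lt_mul_of_pos_left hp hs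
        have h2 := mul_lt_mul_of_pos_left hp' ht
        simp only [PiLp.add_apply, PiLp.smul_apply, smul_eq_mul]
        linarith
    have hsub := convexHull_min h hconv
    refine exposedPoints_subset_extremePoints ⟨subset_convexHull ℝ T hq,
      (x : ℝ) • EuclideanSpace.proj 0 + (y : ℝ) • EuclideanSpace.proj 1, fun p hp => ?_⟩
    have hval (z : EuclideanSpace ℝ (Fin 2)) :
        ((x : ℝ) • EuclideanSpace.proj 0 + (y : ℝ) • EuclideanSpace.proj 1 :
          StrongDual ℝ (EuclideanSpace ℝ (Fin 2))) z = x * z 0 + y * z 1 := by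
      simp
    rw [hval, hval]
    rcases hsub hp with rfl | hlt
    · exact ⟨le_rfl, fun _ => rfl⟩
    · exact ⟨hlt.le, fun hle => absurd hlt (not_lt.2 hle)⟩

/-- The exponents whose projections are the vertices of the shadow, one (of smallest index `r`) for
each vertex. -/
noncomputable def shadowVertices {n : ℕ} (A : Finset (Fin n →₀ ℕ)) (r : (Fin n →₀ ℕ) → ℕ)
    (w : EuclideanSpace ℝ (Fin n) × EuclideanSpace ℝ (Fin n)) : Finset (Fin n →₀ ℕ) :=
  open Classical in
  A.filter fun a => (∃ x y : ℚ, ∀ b ∈ A,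
      shadowMap w.1 w.2 (exponentPoint b) = shadowMap w.1 w.2 (exponentPoint a) ∨
      inner ℝ ((x : ℝ) • w.1 + (y : ℝ) • w.2) (exponentPoint b) <
        inner ℝ ((x : ℝ) • w.1 + (y : ℝ) • w.2) (exponentPoint a)) ∧
    ∀ b ∈ A, r b < r a →
      shadowMap w.1 w.2 (exponentPoint b) ≠ shadowMap w.1 w.2 (exponentPoint a)

lemma injOn_shadowVertices {n : ℕ} (A : Finset (Fin n →₀ ℕ)) {r : (Fin n →₀ ℕ) → ℕ}
    (hr : Function.Injective r) (w : EuclideanSpace ℝ (Fin n) × EuclideanSpace ℝ (Fin n)) :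
    Set.InjOn (fun a => shadowMap w.1 w.2 (exponentPoint a))
      (shadowVertices A r w : Set (Fin n →₀ ℕ)) := by
  intro a ha b hb hab
  simp only [shadowVertices, Finset.coe_filter, Set.mem_ofPred_eq] at ha hb
  refine hr (le_antisymm ?_ ?_)
  · by_contra! h
    exact ha.2.2 b hb.1 h hab.symm
  · by_contra! h
    exact hb.2.2 a ha.1 h hab

lemma shadowSize_convexHull {n : ℕ} (A : Finset (Fin n →₀ ℕ)) {r : (Fin n →₀ ℕ) → ℕ}
    (hr : Function.Injective r) (w : EuclideanSpace ℝ (Fin n) × EuclideanSpace ℝ (Fin n)) :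
    shadowSize (convexHull ℝ (exponentPoint '' (A : Set (Fin n →₀ ℕ)))) w
      = (shadowVertices A r w).card := by
  have hfin : (shadowMap w.1 w.2 '' (exponentPoint '' (A : Set (Fin n →₀ ℕ)))).Finite :=
    (A.finite_toSet.image _).image _
  rw [← Set.ncard_coe_finset, ← (injOn_shadowVertices A hr w).ncard_image, shadowSize,
    LinearMap.image_convexHull]
  congr 1
  ext q
  constructor
  · intro hq
    have hqT := extremePoints_convexHull_subset hq
    obtain ⟨x, y, hxy⟩ := (mem_extremePoints_convexHull_iff_exists_rat hfin hqT).1 hq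
    obtain ⟨-, ⟨a₀, ha₀, rfl⟩, ha₀q⟩ := hqT
    classical
    obtain ⟨a, ha, hmin⟩ := (A.filter fun a =>
      shadowMap w.1 w.2 (exponentPoint a) = q).exists_min_image r
      ⟨a₀, Finset.mem_filter.2 ⟨ha₀, ha₀q⟩⟩
    simp only [Finset.mem_filter] at ha hmin
    refine ⟨a, ?_, ha.2⟩
    simp only [shadowVertices, Finset.coe_filter, Set.mem_ofPred_eq]
    refine ⟨ha.1, ⟨x, y, fun b hb => ?_⟩, fun b hb hba hEq => ?_⟩
    · have := hxy _ ⟨_, ⟨b, hb, rfl⟩, rfl⟩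
      rwa [← ha.2, inner_shadowMap, inner_shadowMap] at this
    · exact absurd hba (not_lt.2 (hmin b ⟨hb, hEq.trans ha.2⟩))
  · rintro ⟨a, ha, rfl⟩
    simp only [shadowVertices, Finset.coe_filter, Set.mem_ofPred_eq] at ha
    obtain ⟨haA, ⟨x, y, hxy⟩, -⟩ := ha
    refine (mem_extremePoints_convexHull_iff_exists_rat hfin
      ⟨_, ⟨a, haA, rfl⟩, rfl⟩).2 ⟨x, y, ?_⟩
    rintro - ⟨-, ⟨b, hb, rfl⟩, rfl⟩
    rw [inner_shadowMap, inner_shadowMap]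
    exact hxy b hb

lemma measurable_shadowMap_apply {n : ℕ} (x : EuclideanSpace ℝ (Fin n)) :
    Measurable fun w : EuclideanSpace ℝ (Fin n) × EuclideanSpace ℝ (Fin n) =>
      shadowMap w.1 w.2 x := by
  have : Continuous fun w : EuclideanSpace ℝ (Fin n) × EuclideanSpace ℝ (Fin n) =>
      shadowMap w.1 w.2 x := by
    refine (PiLp.continuous_toLp 2 _).comp (continuous_pi fun i => ?_)
    fin_cases i
    · exact continuous_fst.inner continuous_const
    · exact continuous_snd.inner continuous_const
  exact this.measurable

/-- Rational directions turn the existential in `shadowVertices` into a countable union. -/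
lemma measurable_card_shadowVertices {n : ℕ} (A : Finset (Fin n →₀ ℕ)) (r : (Fin n →₀ ℕ) → ℕ) :
    Measurable fun w => (shadowVertices A r w).card := by
  classical
  simp only [shadowVertices, Finset.card_filter]
  refine Finset.measurable_sum _ fun a _ => Measurable.ite ?_ measurable_const measurable_const
  have heq (b : Fin n →₀ ℕ) : MeasurableSet {w : EuclideanSpace ℝ (Fin n) × EuclideanSpace ℝ (Fin n)
      | shadowMap w.1 w.2 (exponentPoint b) = shadowMap w.1 w.2 (exponentPoint a)} :=
    measurableSet_eq_fun (measurable_shadowMap_apply _) (measurable_shadowMap_apply _)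
  have hlt (x y : ℚ) (b : Fin n →₀ ℕ) :
      MeasurableSet {w : EuclideanSpace ℝ (Fin n) × EuclideanSpace ℝ (Fin n) |
        inner ℝ ((x : ℝ) • w.1 + (y : ℝ) • w.2) (exponentPoint b) <
        inner ℝ ((x : ℝ) • w.1 + (y : ℝ) • w.2) (exponentPoint a)} :=
    measurableSet_lt (by fun_prop) (by fun_prop)
  have h := (MeasurableSet.iUnion fun x : ℚ => MeasurableSet.iUnion fun y : ℚ =>
    A.measurableSet_biInter fun b _ => (heq b).union (hlt x y b)).inter
    (A.measurableSet_biInter fun b _ => MeasurableSet.iInter fun _ : r b < r a => (heq b).compl)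
  convert h using 1
  ext w
  simp

/-! ### Vertices bounded by argmax changes along the sides of a square -/

/-- The `i`-th point of the subdivision of `[-1, 1]` into `2 N` intervals. -/
noncomputable def gridPoint (N i : ℕ) : ℝ := -1 + i / N

lemma eventually_exists_gridPoint_mem {O : Set ℝ} (hO : IsOpen O) {t : ℝ} (ht : t ∈ O)
    (h1 : |t| ≤ 1) : ∀ᶠ N : ℕ in Filter.atTop, ∃ i ∈ Finset.range (2 * N + 1), gridPoint N i ∈ O := by
  obtain ⟨ε, hε, hball⟩ := Metric.isOpen_iff.1 hO t ht
  obtain ⟨M, hM⟩ := exists_nat_gt (1 / ε)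
  filter_upwards [Filter.eventually_ge_atTop M, Filter.eventually_ge_atTop 1] with N hN hN1
  have hNpos : (0 : ℝ) < N := by exact_mod_cast hN1
  have hNε : 1 / (N : ℝ) < ε := by
    rw [one_div_lt hNpos hε]
    exact hM.trans_le (by exact_mod_cast hN)
  have ht' := abs_le.1 h1
  have hnn : 0 ≤ (t + 1) * N := mul_nonneg (by linarith) hNpos.le
  have hfl := Nat.floor_le hnn
  have hlt := Nat.lt_floor_add_one ((t + 1) * N)
  -- The grid point just below `t`, at distance less than `1 / N < ε`.
  refine ⟨⌊(t + 1) * N⌋₊, ?_, hball ?_⟩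
  · rw [Finset.mem_range, Nat.lt_succ_iff]
    have : (⌊(t + 1) * N⌋₊ : ℝ) ≤ (2 * N : ℕ) := by
      push_cast
      nlinarith
    exact_mod_cast this
  · rw [Metric.mem_ball, Real.dist_eq, gridPoint, abs_lt]
    have h2 : (⌊(t + 1) * N⌋₊ : ℝ) / N ≤ t + 1 := by rwa [div_le_iff₀ hNpos]
    have h3 : t + 1 < (⌊(t + 1) * N⌋₊ : ℝ) / N + 1 / N := by
      rw [← add_div, lt_div_iff₀ hNpos]; exact hlt
    constructor <;> linarith

/-- The number of changes of `f` along the subdivision of the segment from `g - h` to `g + h`. -/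
noncomputable def switchCount {n : ℕ} (f : EuclideanSpace ℝ (Fin n) → (Fin n →₀ ℕ)) (N : ℕ)
    (g h : EuclideanSpace ℝ (Fin n)) : ℕ :=
  open Classical in
  ((Finset.range (2 * N)).filter fun i =>
    f (g + gridPoint N i • h) ≠ f (g + gridPoint N (i + 1) • h)).card

lemma card_image_range_succ_le {α : Type*} [DecidableEq α] (f : ℕ → α) (m : ℕ) :
    ((Finset.range (m + 1)).image f).card
      ≤ 1 + ((Finset.range m).filter fun i => f i ≠ f (i + 1)).card := by
  induction m with
  | zero => simp
  | succ m ih =>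
    rw [Finset.range_add_one, Finset.image_insert]
    by_cases h : f m = f (m + 1)
    · rw [Finset.insert_eq_of_mem (Finset.mem_image.2 ⟨m, by simp, h⟩)]
      exact ih.trans (by gcongr; simp)
    · have h2 : ((Finset.range (m + 1)).filter fun i => f i ≠ f (i + 1)).card
          = ((Finset.range m).filter fun i => f i ≠ f (i + 1)).card + 1 := by
        rw [Finset.range_add_one, Finset.filter_insert, if_pos h,
          Finset.card_insert_of_notMem (by simp)]
      exact (Finset.card_insert_le _ _).trans (by omega)

/-- A nonempty open cone in the plane contains, for fine subdivisions, a subdivision point of a side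
of the square `[-1, 1]²`. -/
lemma eventually_exists_gridPoint_mem_cone {O : Set (ℝ × ℝ)} (hO : IsOpen O) (hne : O.Nonempty)
    (hcone : ∀ s : ℝ, 0 < s → ∀ z ∈ O, s • z ∈ O) :
    (∀ᶠ N : ℕ in Filter.atTop, ∃ i ∈ Finset.range (2 * N + 1), (1, gridPoint N i) ∈ O) ∨
    (∀ᶠ N : ℕ in Filter.atTop, ∃ i ∈ Finset.range (2 * N + 1), (-1, gridPoint N i) ∈ O) ∨
    (∀ᶠ N : ℕ in Filter.atTop, ∃ i ∈ Finset.range (2 * N + 1), (gridPoint N i, 1) ∈ O) ∨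
    (∀ᶠ N : ℕ in Filter.atTop, ∃ i ∈ Finset.range (2 * N + 1), (gridPoint N i, -1) ∈ O) := by
  -- Openness allows a nonzero point of the cone; dividing by its larger coordinate in absolute
  -- value lands on a side of the square.
  obtain ⟨⟨c, d⟩, hz, hz0⟩ := (dense_compl_singleton (0 : ℝ × ℝ)).inter_open_nonempty O hO hne
  have hleft (a : ℝ) : IsOpen {t : ℝ | (a, t) ∈ O} := hO.preimage (by fun_prop)
  have hright (a : ℝ) : IsOpen {t : ℝ | (t, a) ∈ O} := hO.preimage (by fun_prop)
  rcases le_total |d| |c| with hdc | hdc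
  · have hc : c ≠ 0 := by
      rintro rfl
      simp only [abs_zero, abs_nonpos_iff] at hdc
      exact hz0 (by simp [hdc])
    have hc' : 0 < |c| := abs_pos.2 hc
    have hm := hcone |c|⁻¹ (inv_pos.2 hc') _ hz
    have hb : |(|c|⁻¹ * d)| ≤ 1 := by
      rw [abs_mul, abs_inv, abs_abs, inv_mul_le_iff₀ hc', mul_one]
      exact hdc
    rcases hc.lt_or_gt with h | h
    · refine Or.inr (Or.inl (eventually_exists_gridPoint_mem (hleft (-1)) ?_ hb))
      have : |c|⁻¹ * c = -1 := by rw [abs_of_neg h]; field_simp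
      simpa [this] using hm
    · refine Or.inl (eventually_exists_gridPoint_mem (hleft 1) ?_ hb)
      have : |c|⁻¹ * c = 1 := by rw [abs_of_pos h]; field_simp
      simpa [this] using hm
  · have hc : d ≠ 0 := by
      rintro rfl
      simp only [abs_zero, abs_nonpos_iff] at hdc
      exact hz0 (by simp [hdc])
    have hc' : 0 < |d| := abs_pos.2 hc
    have hm := hcone |d|⁻¹ (inv_pos.2 hc') _ hz
    have hb : |(|d|⁻¹ * c)| ≤ 1 := by
      rw [abs_mul, abs_inv, abs_abs, inv_mul_le_iff₀ hc', mul_one]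
      exact hdc
    rcases hc.lt_or_gt with h | h
    · refine Or.inr (Or.inr (Or.inr (eventually_exists_gridPoint_mem (hright (-1)) ?_ hb)))
      have : |d|⁻¹ * d = -1 := by rw [abs_of_neg h]; field_simp
      simpa [this] using hm
    · refine Or.inr (Or.inr (Or.inl (eventually_exists_gridPoint_mem (hright 1) ?_ hb)))
      have : |d|⁻¹ * d = 1 := by rw [abs_of_pos h]; field_simp
      simpa [this] using hm

/-- A shadow along a plane inside the span of `g` and `h` has at most as many vertices as the
argmax selection takes values along the four sides of the square of directions. -/
lemma IsArgmaxSelection.eventually_card_shadowVertices_le {n : ℕ} {A : Finset (Fin n →₀ ℕ)}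
    {r r' : (Fin n →₀ ℕ) → ℕ} {f : EuclideanSpace ℝ (Fin n) → (Fin n →₀ ℕ)}
    (hf : IsArgmaxSelection A r f) (hr : Function.Injective r')
    (w : EuclideanSpace ℝ (Fin n) × EuclideanSpace ℝ (Fin n)) (g h : EuclideanSpace ℝ (Fin n))
    (h1 : w.1 ∈ Submodule.span ℝ {g, h}) (h2 : w.2 ∈ Submodule.span ℝ {g, h}) :
    ∀ᶠ N : ℕ in Filter.atTop, (shadowVertices A r' w).card ≤
      (1 + switchCount f N g h) + (1 + switchCount f N (-g) h) +
      ((1 + switchCount f N h g) + (1 + switchCount f N (-h) g)) := by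
  classical
  let π (a : Fin n →₀ ℕ) := shadowMap w.1 w.2 (exponentPoint a)
  let I (N : ℕ) (u v : EuclideanSpace ℝ (Fin n)) : Finset (Fin n →₀ ℕ) :=
    (Finset.range (2 * N + 1)).image fun i => f (u + gridPoint N i • v)
  have hI (N : ℕ) (u v : EuclideanSpace ℝ (Fin n)) : ((I N u v).image π).card
      ≤ 1 + switchCount f N u v := by
    refine Finset.card_image_le.trans ((card_image_range_succ_le _ _).trans ?_)
    rw [switchCount]
  have hmem : ∀ a ∈ shadowVertices A r' w, ∀ᶠ N : ℕ in Filter.atTop,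
      π a ∈ ((I N g h).image π ∪ (I N (-g) h).image π) ∪
        ((I N h g).image π ∪ (I N (-h) g).image π) := by
    intro a ha
    simp only [shadowVertices, Finset.mem_filter] at ha
    obtain ⟨haA, ⟨x, y, hxy⟩, -⟩ := ha
    -- Coefficients of the directions `z.1 • g + z.2 • h` in which `π a` strictly wins. Exponents
    -- with the same projection are exempt, so only `π` of the argmax is determined (`hval`); this
    -- also lets `r` and `r'` differ.
    let O : Set (ℝ × ℝ) := {z | ∀ b ∈ A, π b = π a ∨
      inner ℝ (z.1 • g + z.2 • h) (exponentPoint b) < inner ℝ (z.1 • g + z.2 • h) (exponentPoint a)}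
    have hO : IsOpen O := by
      have : O = ⋂ b ∈ A, ({z | π b = π a} ∪ {z | inner ℝ (z.1 • g + z.2 • h) (exponentPoint b) <
          inner ℝ (z.1 • g + z.2 • h) (exponentPoint a)}) := by
        ext z; simp [O]
      rw [this]
      refine isOpen_biInter_finset fun b _ => isOpen_const.union ?_
      exact isOpen_lt (by fun_prop) (by fun_prop)
    have hne : O.Nonempty := by
      have hs : (x : ℝ) • w.1 + (y : ℝ) • w.2 ∈ Submodule.span ℝ {g, h} :=
        add_mem (Submodule.smul_mem _ _ h1) (Submodule.smul_mem _ _ h2)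
      obtain ⟨c, d, hcd⟩ := Submodule.mem_span_pair.1 hs
      refine ⟨(c, d), fun b hb => ?_⟩
      simp only [hcd]
      exact hxy b hb
    have hcone : ∀ s : ℝ, 0 < s → ∀ z ∈ O, s • z ∈ O := by
      intro s hs z hz b hb
      refine (hz b hb).imp id fun hlt => ?_
      have h3 : (s • z).1 • g + (s • z).2 • h = s • (z.1 • g + z.2 • h) := by
        simp [smul_smul, smul_add]
      rw [h3, real_inner_smul_left, real_inner_smul_left]
      exact mul_lt_mul_of_pos_left hlt hs
    have hval : ∀ z ∈ O, π (f (z.1 • g + z.2 • h)) = π a := fun z hz =>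
      (hz _ (hf.mem _)).resolve_right (not_lt.2 (hf.inner_le _ a haA))
    have hin (N i : ℕ) (u v : EuclideanSpace ℝ (Fin n)) (z : ℝ × ℝ)
        (hi : i ∈ Finset.range (2 * N + 1)) (hz : z ∈ O)
        (huv : u + gridPoint N i • v = z.1 • g + z.2 • h) : π a ∈ (I N u v).image π := by
      rw [← hval z hz, ← huv]
      exact Finset.mem_image_of_mem _ (Finset.mem_image_of_mem _ hi)
    rcases eventually_exists_gridPoint_mem_cone hO hne hcone with H | H | H | H
    all_goals
      filter_upwards [H] with N hN
      obtain ⟨i, hi, hz⟩ := hN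
      simp only [Finset.mem_union]
    · exact Or.inl (Or.inl (hin N i _ _ _ hi hz (by simp)))
    · exact Or.inl (Or.inr (hin N i _ _ _ hi hz (by simp)))
    · exact Or.inr (Or.inl (hin N i _ _ _ hi hz (by simp [add_comm])))
    · exact Or.inr (Or.inr (hin N i _ _ _ hi hz (by simp [add_comm])))
  filter_upwards [(Filter.eventually_all_finset _).2 hmem] with N hN
  rw [← Finset.card_image_of_injOn (injOn_shadowVertices A hr w)]
  refine (Finset.card_le_card (Finset.image_subset_iff.2 hN)).trans ?_
  refine (Finset.card_union_le _ _).trans (add_le_add ?_ ?_)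
  · exact (Finset.card_union_le _ _).trans (add_le_add (hI _ _ _) (hI _ _ _))
  · exact (Finset.card_union_le _ _).trans (add_le_add (hI _ _ _) (hI _ _ _))

/-! ### Expected number of argmax changes -/

lemma lintegral_abs_coord_stdGaussian_le {n : ℕ} (j : Fin n) :
    ∫⁻ h : EuclideanSpace ℝ (Fin n), ENNReal.ofReal |h j| ∂stdGaussian (EuclideanSpace ℝ (Fin n))
      ≤ 1 := by
  let L : StrongDual ℝ (EuclideanSpace ℝ (Fin n)) := innerSL ℝ (EuclideanSpace.single j 1)
  have hL (h : EuclideanSpace ℝ (Fin n)) : L h = h j := by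
    simp [L, EuclideanSpace.inner_single_left]
  have hmem : MemLp L 2 (stdGaussian (EuclideanSpace ℝ (Fin n))) :=
    IsGaussian.memLp_dual _ L 2 (by simp)
  have hvar := variance_dual_stdGaussian L
  rw [variance_of_integral_eq_zero L.continuous.aemeasurable (integral_strongDual_stdGaussian L),
    innerSL_apply_norm, PiLp.norm_single] at hvar
  have hint : Integrable (fun h => (1 + L h ^ 2) / 2) (stdGaussian (EuclideanSpace ℝ (Fin n))) :=
    ((integrable_const 1).add hmem.integrable_sq).div_const 2
  calc _ ≤ ∫⁻ h, ENNReal.ofReal ((1 + L h ^ 2) / 2) ∂stdGaussian (EuclideanSpace ℝ (Fin n)) := by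
        refine lintegral_mono fun h => ENNReal.ofReal_le_ofReal ?_
        rw [hL, ← sq_abs]
        nlinarith [sq_nonneg (|h j| - 1)]
    _ = ENNReal.ofReal (∫ h, (1 + L h ^ 2) / 2 ∂stdGaussian (EuclideanSpace ℝ (Fin n))) :=
        (ofReal_integral_eq_lintegral_ofReal hint (ae_of_all _ fun h => by positivity)).symm
    _ = 1 := by
        rw [integral_div, integral_add (integrable_const 1) hmem.integrable_sq, hvar]
        simp

namespace IsArgmaxSelection

variable {n : ℕ} {A : Finset (Fin n →₀ ℕ)} {r : (Fin n →₀ ℕ) → ℕ}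
  {f : EuclideanSpace ℝ (Fin n) → (Fin n →₀ ℕ)}

lemma switchCount_eq_sum (N : ℕ) (g h : EuclideanSpace ℝ (Fin n)) :
    (switchCount f N g h : ℝ≥0∞) = ∑ i ∈ Finset.range (2 * N),
      {z : EuclideanSpace ℝ (Fin n) × EuclideanSpace ℝ (Fin n) |
        f (z.1 + gridPoint N i • z.2) ≠ f (z.1 + gridPoint N (i + 1) • z.2)}.indicator
        (1 : EuclideanSpace ℝ (Fin n) × EuclideanSpace ℝ (Fin n) → ℝ≥0∞) (g, h) := by
  classical
  simp [switchCount, Finset.card_filter, Set.indicator_apply]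

lemma measurable_switchCount (hf : IsArgmaxSelection A r f) (hr : Function.Injective r) (N : ℕ) :
    Measurable fun z : EuclideanSpace ℝ (Fin n) × EuclideanSpace ℝ (Fin n) =>
      (switchCount f N z.1 z.2 : ℝ≥0∞) := by
  simp only [switchCount_eq_sum]
  have hm (i : ℕ) : Measurable fun z : EuclideanSpace ℝ (Fin n) × EuclideanSpace ℝ (Fin n) =>
      z.1 + gridPoint N i • z.2 := by fun_prop
  exact Finset.measurable_fun_sum _ fun i _ =>
    measurable_one.indicator (hf.measurableSet_ne hr (hm i) (hm (i + 1)))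

/-- Each of the `2N` steps shifts by `h / N`, so the bound does not depend on `N`. -/
lemma lintegral_switchCount_left_le (hf : IsArgmaxSelection A r f) (hr : Function.Injective r)
    {k : ℕ} (hk : ∀ a ∈ A, ∀ i, a i ≤ k) {N : ℕ} (hN : 0 < N) (h : EuclideanSpace ℝ (Fin n)) :
    ∫⁻ g, switchCount f N g h ∂stdGaussian (EuclideanSpace ℝ (Fin n))
      ≤ 2 * k * ∑ j, ENNReal.ofReal |h j| := by
  have hS (i : ℕ) : MeasurableSet {g : EuclideanSpace ℝ (Fin n) |
      f (g + gridPoint N i • h) ≠ f (g + gridPoint N (i + 1) • h)} :=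
    hf.measurableSet_ne hr (by fun_prop) (by fun_prop)
  have hNR : (0 : ℝ) < N := by exact_mod_cast hN
  have hstep (i : ℕ) : stdGaussian (EuclideanSpace ℝ (Fin n))
      {g | f (g + gridPoint N i • h) ≠ f (g + gridPoint N (i + 1) • h)}
      ≤ k * ((N : ℝ≥0∞)⁻¹ * ∑ j, ENNReal.ofReal |h j|) := by
    have h1 : gridPoint N (i + 1) • h = gridPoint N i • h + (N : ℝ)⁻¹ • h := by
      rw [← add_smul, gridPoint, gridPoint]
      push_cast
      congr 1
      ring
    rw [h1]
    refine (hf.stdGaussian_ne_le hr hk _ _).trans_eq ?_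
    congr 1
    rw [Finset.mul_sum]
    refine Finset.sum_congr rfl fun j _ => ?_
    rw [PiLp.smul_apply, smul_eq_mul, abs_mul, ENNReal.ofReal_mul (abs_nonneg _),
      abs_of_pos (inv_pos.2 hNR), ENNReal.ofReal_inv_of_pos hNR, ENNReal.ofReal_natCast]
  have hsum (g : EuclideanSpace ℝ (Fin n)) : (switchCount f N g h : ℝ≥0∞) =
      ∑ i ∈ Finset.range (2 * N), {g : EuclideanSpace ℝ (Fin n) |
        f (g + gridPoint N i • h) ≠ f (g + gridPoint N (i + 1) • h)}.indicator 1 g := by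
    rw [switchCount_eq_sum]; rfl
  simp only [hsum]
  rw [lintegral_finsetSum _ fun i _ => measurable_one.indicator (hS i)]
  simp only [lintegral_indicator_one (hS _)]
  refine (Finset.sum_le_sum fun i _ => hstep i).trans_eq ?_
  rw [Finset.sum_const, Finset.card_range, nsmul_eq_mul]
  have hc : (N : ℝ≥0∞) * (N : ℝ≥0∞)⁻¹ = 1 :=
    ENNReal.mul_inv_cancel (by exact_mod_cast hN.ne') (by simp)
  push_cast
  calc (2 * N : ℝ≥0∞) * (k * ((N : ℝ≥0∞)⁻¹ * ∑ j, ENNReal.ofReal |h j|))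
      = (N * (N : ℝ≥0∞)⁻¹) * (2 * k * ∑ j, ENNReal.ofReal |h j|) := by ring
    _ = _ := by rw [hc, one_mul]

lemma lintegral_switchCount_le (hf : IsArgmaxSelection A r f) (hr : Function.Injective r)
    {k : ℕ} (hk : ∀ a ∈ A, ∀ i, a i ≤ k) {N : ℕ} (hN : 0 < N) :
    ∫⁻ z, switchCount f N z.1 z.2 ∂(stdGaussian (EuclideanSpace ℝ (Fin n))).prod
      (stdGaussian (EuclideanSpace ℝ (Fin n))) ≤ 2 * k * n := by
  rw [lintegral_prod_symm' _ (hf.measurable_switchCount hr N)]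
  refine (lintegral_mono fun h => hf.lintegral_switchCount_left_le hr hk hN h).trans ?_
  have hm (j : Fin n) : Measurable fun h : EuclideanSpace ℝ (Fin n) => ENNReal.ofReal |h j| := by
    fun_prop
  rw [lintegral_const_mul _ (by fun_prop), lintegral_finsetSum _ fun j _ => hm j]
  gcongr
  refine (Finset.sum_le_sum fun j _ => lintegral_abs_coord_stdGaussian_le j).trans_eq ?_
  simp

/-- The Gaussian law is symmetric, so the opposite side of the square costs the same. -/
lemma lintegral_switchCount_neg_le (hf : IsArgmaxSelection A r f) (hr : Function.Injective r)
    {k : ℕ} (hk : ∀ a ∈ A, ∀ i, a i ≤ k) {N : ℕ} (hN : 0 < N) :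
    ∫⁻ z, switchCount f N (-z.1) z.2 ∂(stdGaussian (EuclideanSpace ℝ (Fin n))).prod
      (stdGaussian (EuclideanSpace ℝ (Fin n))) ≤ 2 * k * n := by
  refine le_trans (le_of_eq ?_) (hf.lintegral_switchCount_le hr hk hN)
  have h1 : (stdGaussian (EuclideanSpace ℝ (Fin n))).map (fun x => -x)
      = stdGaussian (EuclideanSpace ℝ (Fin n)) :=
    stdGaussian_map (LinearIsometryEquiv.neg ℝ (E := EuclideanSpace ℝ (Fin n)))
  have hp : MeasurePreserving
      (Prod.map (fun x : EuclideanSpace ℝ (Fin n) => -x) (id : EuclideanSpace ℝ (Fin n) → _))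
      ((stdGaussian (EuclideanSpace ℝ (Fin n))).prod (stdGaussian (EuclideanSpace ℝ (Fin n))))
      ((stdGaussian (EuclideanSpace ℝ (Fin n))).prod (stdGaussian (EuclideanSpace ℝ (Fin n)))) :=
    MeasurePreserving.prod ⟨measurable_neg, h1⟩ (MeasurePreserving.id _)
  exact hp.lintegral_comp (hf.measurable_switchCount hr N)

end IsArgmaxSelection

lemma orthonormalizePair_mem_span {n : ℕ}
    (z : EuclideanSpace ℝ (Fin n) × EuclideanSpace ℝ (Fin n)) :
    (orthonormalizePair z).1 ∈ Submodule.span ℝ {z.1, z.2} ∧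
      (orthonormalizePair z).2 ∈ Submodule.span ℝ {z.1, z.2} := by
  have h1 : z.1 ∈ Submodule.span ℝ {z.1, z.2} := Submodule.subset_span (by simp)
  have h2 : z.2 ∈ Submodule.span ℝ {z.1, z.2} := Submodule.subset_span (by simp)
  exact ⟨Submodule.smul_mem _ _ h1, Submodule.smul_mem _ _
    (sub_mem h2 (Submodule.smul_mem _ _ (Submodule.smul_mem _ _ h1)))⟩

lemma lintegral_four_one_add_le {α : Type*} [MeasurableSpace α] {μ : Measure α}
    [IsProbabilityMeasure μ] {s₁ s₂ s₃ s₄ : α → ℝ≥0∞} (h₁ : Measurable s₁) (h₂ : Measurable s₂)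
    (h₃ : Measurable s₃) {B : ℝ≥0∞} (b₁ : ∫⁻ x, s₁ x ∂μ ≤ B)
    (b₂ : ∫⁻ x, s₂ x ∂μ ≤ B) (b₃ : ∫⁻ x, s₃ x ∂μ ≤ B) (b₄ : ∫⁻ x, s₄ x ∂μ ≤ B) :
    ∫⁻ x, ((1 + s₁ x) + (1 + s₂ x) + ((1 + s₃ x) + (1 + s₄ x))) ∂μ ≤ 4 * (1 + B) := by
  have h (s : α → ℝ≥0∞) (b : ∫⁻ x, s x ∂μ ≤ B) : ∫⁻ x, (1 + s x) ∂μ ≤ 1 + B := by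
    rw [lintegral_add_left measurable_const]
    simpa using b
  have m₁₂ : Measurable fun x => 1 + s₁ x + (1 + s₂ x) := (h₁.const_add 1).add (h₂.const_add 1)
  rw [lintegral_add_left m₁₂,
    lintegral_add_left (h₁.const_add 1), lintegral_add_left (h₃.const_add 1)]
  refine (add_le_add (add_le_add (h _ b₁) (h _ b₂)) (add_le_add (h _ b₃) (h _ b₄))).trans_eq ?_
  ring

namespace IsArgmaxSelection

variable {n : ℕ} {A : Finset (Fin n →₀ ℕ)} {r : (Fin n →₀ ℕ) → ℕ}
  {f : EuclideanSpace ℝ (Fin n) → (Fin n →₀ ℕ)}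

lemma measurable_switchCount_neg (hf : IsArgmaxSelection A r f) (hr : Function.Injective r)
    (N : ℕ) : Measurable fun z : EuclideanSpace ℝ (Fin n) × EuclideanSpace ℝ (Fin n) =>
      (switchCount f N (-z.1) z.2 : ℝ≥0∞) := by
  have hφ : Measurable fun z : EuclideanSpace ℝ (Fin n) × EuclideanSpace ℝ (Fin n) =>
      (-z.1, z.2) := by fun_prop
  have h := (hf.measurable_switchCount hr N).comp hφ
  exact h

lemma measurable_boundarySwitchCount (hf : IsArgmaxSelection A r f) (hr : Function.Injective r)
    (N : ℕ) : Measurable fun z : EuclideanSpace ℝ (Fin n) × EuclideanSpace ℝ (Fin n) =>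
      ((1 + switchCount f N z.1 z.2) + (1 + switchCount f N (-z.1) z.2) +
        ((1 + switchCount f N z.2 z.1) + (1 + switchCount f N (-z.2) z.1)) : ℝ≥0∞) :=
  have h1 := hf.measurable_switchCount hr N
  have h2 := hf.measurable_switchCount_neg hr N
  ((h1.const_add 1).add (h2.const_add 1)).add
    (((h1.comp measurable_swap).const_add 1).add ((h2.comp measurable_swap).const_add 1))

lemma lintegral_boundarySwitchCount_le (hf : IsArgmaxSelection A r f) (hr : Function.Injective r)
    {k : ℕ} (hk : ∀ a ∈ A, ∀ i, a i ≤ k) {N : ℕ} (hN : 0 < N) :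
    ∫⁻ z, ((1 + switchCount f N z.1 z.2) + (1 + switchCount f N (-z.1) z.2) +
        ((1 + switchCount f N z.2 z.1) + (1 + switchCount f N (-z.2) z.1)) : ℝ≥0∞)
      ∂(stdGaussian (EuclideanSpace ℝ (Fin n))).prod (stdGaussian (EuclideanSpace ℝ (Fin n)))
      ≤ 4 * (1 + 2 * k * n) := by
  have h1 := hf.measurable_switchCount hr N
  have h2 := hf.measurable_switchCount_neg hr N
  have e1 := hf.lintegral_switchCount_le hr hk hN
  have e2 := hf.lintegral_switchCount_neg_le hr hk hN
  refine lintegral_four_one_add_le h1 h2 (h1.comp measurable_swap) e1 e2 ?_ ?_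
  · exact (lintegral_prod_swap _).trans_le e1
  · exact (lintegral_prod_swap
      (fun z => (switchCount f N (-z.1) z.2 : ℝ≥0∞))).trans_le e2

end IsArgmaxSelection

/-! ### Expected shadow size -/

/-- The expected number of vertices of the random shadow of a polytope with vertices in
`{0, …, k}ⁿ` is at most `4 (1 + 2 k n)`. -/
lemma lintegral_card_shadowVertices_le {n : ℕ} {A : Finset (Fin n →₀ ℕ)} (hA : A.Nonempty)
    {r : (Fin n →₀ ℕ) → ℕ} (hr : Function.Injective r) {k : ℕ} (hk : ∀ a ∈ A, ∀ i, a i ≤ k) :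
    ∫⁻ w, ((shadowVertices A r w).card : ℝ≥0∞) ∂uniformFrame n ≤ 4 * (1 + 2 * k * n) := by
  obtain ⟨f, hf⟩ := exists_isArgmaxSelection hA r
  have hcard : Measurable fun w => ((shadowVertices A r w).card : ℝ≥0∞) :=
    measurable_from_top.comp (measurable_card_shadowVertices A r)
  rw [uniformFrame, lintegral_map hcard (measurable_orthonormalizePair n)]
  -- How fine the grid must be depends on `z`, so the pointwise bound is by a `liminf`, and Fatou's
  -- lemma exchanges it with the integral.
  refine (lintegral_mono fun z => Filter.le_liminf_of_le (f := Filter.atTop) (by isBoundedDefault) ?_).trans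
    ((lintegral_liminf_le (hf.measurable_boundarySwitchCount hr)).trans
    (Filter.liminf_le_of_frequently_le' (Filter.Eventually.frequently ?_)))
  · obtain ⟨h1, h2⟩ := orthonormalizePair_mem_span z
    filter_upwards [hf.eventually_card_shadowVertices_le hr (orthonormalizePair z) z.1 z.2
      h1 h2] with N hN
    exact_mod_cast hN
  · filter_upwards [Filter.eventually_gt_atTop 0] with N hN
    exact hf.lintegral_boundarySwitchCount_le hr hk hN

lemma one_le_shadowSize_convexHull {n : ℕ} {A : Finset (Fin n →₀ ℕ)} (hA : A.Nonempty)
    (w : EuclideanSpace ℝ (Fin n) × EuclideanSpace ℝ (Fin n)) :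
    1 ≤ shadowSize (convexHull ℝ (exponentPoint '' (A : Set (Fin n →₀ ℕ)))) w := by
  have hfin : (shadowMap w.1 w.2 '' (exponentPoint '' (A : Set (Fin n →₀ ℕ)))).Finite :=
    (A.finite_toSet.image _).image _
  rw [shadowSize, LinearMap.image_convexHull, Nat.one_le_iff_ne_zero, ← Nat.pos_iff_ne_zero,
    Set.ncard_pos (hfin.subset extremePoints_convexHull_subset)]
  -- Krein–Milman: a nonempty compact set has an extreme point.
  refine (hfin.isCompact_convexHull ℝ).extremePoints_nonempty ?_
  exact (((Finset.coe_nonempty.2 hA).image _).image _).convexHull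

theorem mainTheorem9 :
    ∃ C : ℝ, 0 < C ∧
      ∀ (n : ℕ), 2 ≤ n → ∀ (k : ℕ) (p : MvPolynomial (Fin n) ℝ), p ≠ 0 → p.totalDegree = k →
        Integrable (fun w => (shadowSize (newtonPolytope p) w : ℝ)) (uniformFrame n) ∧
        1 ≤ ∫ w, (shadowSize (newtonPolytope p) w : ℝ) ∂(uniformFrame n) ∧
        (1 ≤ k →
          ∫ w, (shadowSize (newtonPolytope p) w : ℝ) ∂(uniformFrame n) ≤ C * ((n : ℝ) * k)) := by
  -- `4 (1 + 2kn) ≤ 12 kn` once `kn ≥ 1`.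
  refine ⟨12, by norm_num, fun n hn k p hp hpk => ?_⟩
  have hA : p.support.Nonempty := MvPolynomial.support_nonempty.2 hp
  have hk : ∀ a ∈ p.support, ∀ i, a i ≤ k := fun a ha i =>
    (Finsupp.le_degree i a).trans ((MvPolynomial.le_totalDegree ha).trans_eq hpk)
  obtain ⟨r, hr⟩ := exists_injective_nat (Fin n →₀ ℕ)
  have hsize (w : EuclideanSpace ℝ (Fin n) × EuclideanSpace ℝ (Fin n)) :
      shadowSize (newtonPolytope p) w = (shadowVertices p.support r w).card :=
    shadowSize_convexHull p.support hr w
  have hmeas : Measurable fun w => (shadowSize (newtonPolytope p) w : ℝ) := by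
    simp only [hsize]
    exact measurable_from_top.comp (measurable_card_shadowVertices p.support r)
  have hle : ∫⁻ w, ENNReal.ofReal (shadowSize (newtonPolytope p) w) ∂uniformFrame n
      ≤ ENNReal.ofReal (4 * (1 + 2 * k * n)) := by
    have h := lintegral_card_shadowVertices_le hA hr hk
    have h4 : (4 * (1 + 2 * k * n) : ℝ≥0∞) = ENNReal.ofReal (4 * (1 + 2 * k * n)) := by
      rw [← ENNReal.ofReal_natCast k, ← ENNReal.ofReal_natCast n]
      rw [ENNReal.ofReal_mul (by norm_num), ENNReal.ofReal_add (by norm_num) (by positivity),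
        ENNReal.ofReal_mul (by positivity), ENNReal.ofReal_mul (by norm_num)]
      simp
    rw [h4] at h
    simpa only [hsize, ENNReal.ofReal_natCast] using h
  have hint : Integrable (fun w => (shadowSize (newtonPolytope p) w : ℝ)) (uniformFrame n) := by
    refine ⟨hmeas.aestronglyMeasurable, ?_⟩
    rw [hasFiniteIntegral_iff_ofReal (ae_of_all _ fun w => Nat.cast_nonneg _)]
    exact hle.trans_lt ENNReal.ofReal_lt_top
  refine ⟨hint, ?_, fun hk1 => ?_⟩
  · have h := integral_mono (integrable_const (1 : ℝ)) hint fun w => by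
      exact Nat.one_le_cast.2 (one_le_shadowSize_convexHull hA w)
    simpa using h
  · rw [← ofReal_integral_eq_lintegral_ofReal hint (ae_of_all _ fun w => Nat.cast_nonneg _),
      ENNReal.ofReal_le_ofReal_iff (by positivity)] at hle
    have h1 : (1 : ℝ) ≤ n * k := by
      exact_mod_cast Nat.mul_pos (by omega) hk1
    nlinarith
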